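/- For integers $s\ge 2$ and $p\ge 1$ let $\Theta^{(s,p)}$ be the generalized theta graph: two distinct endvertices $x,y$ connected by $p$ internally disjoint paths, each with $s$ edges. Let $\Theta^{(s,p)}+K_2$ denote its join with the complete graph on two vertices, i.e. the disjoint union of the two graphs together with all edges between them. For a finite simple graph $G$ let $P_G$ be its chromatic polynomial, i.e. the unique polynomial $P_G\in\mathbb C[q]$ whose value at each integer $k\ge 1$ is the number of proper colorings of $G$ with $k$ colors; a chromatic root of $G$ is a number $q\in\mathbb C$ with $P_G(q)=0$. **Corollary 1.3.** There is a countably infinite family of (not necessarily planar) pairwise non-isomorphic finite graphs whose chromatic roots, taken together, are dense in the whole complex plane. More precisely, the family consisting, up to isomorphism, of exactly the graphs $\Theta^{(s,p)}$ and $\Theta^{(s,p)}+K_2$ with $s\ge 2$, $p\ge 1$ is countably infinite, and the set of all chromatic roots of these graphs is dense in $\mathbb C$. -/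

import Mathlib

/-- The proper colorings of `G` with `k` colors correspond to pairs consisting of a partition of
the vertex set into independent classes and an injective assignment of colors to the classes. -/
theorem exists_polynomial_eval_eq_card_coloring {V : Type*} [Finite V] (G : SimpleGraph V) :
    ∃ P : Polynomial ℂ, ∀ k : ℕ, P.eval (k : ℂ) = (Nat.card (G.Coloring (Fin k)) : ℂ) := by
  classical
  have : Fintype V := Fintype.ofFinite V
  let I := {r : Setoid V // ∀ u v, G.Adj u v → ¬ r u v}
  have : Finite (Setoid V) :=
    Finite.of_injective (fun r : Setoid V => fun u v => r u v)
      (fun r₁ r₂ h => Setoid.ext fun u v => by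
        have := congrFun (congrFun h u) v
        exact iff_of_eq this)
  have : Finite I := Subtype.finite
  have : Fintype I := Fintype.ofFinite I
  have : ∀ r : I, Fintype (Quotient r.1) := fun r => Fintype.ofFinite _
  refine ⟨∑ r : I, descPochhammer ℂ (Fintype.card (Quotient r.1)), fun k => ?_⟩
  let e : G.Coloring (Fin k) ≃ Σ r : I, (Quotient r.1 ↪ Fin k) :=
    Equiv.ofBijective
      (fun c => ⟨⟨Setoid.ker c, fun u v h => c.valid h⟩,
        ⟨Quotient.lift c (fun _ _ h => h), by
          rintro ⟨a⟩ ⟨b⟩ h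
          exact Quotient.sound h⟩⟩) (by
      constructor
      · intro c d h
        have key : ∀ (x y : Σ r : I, (Quotient r.1 ↪ Fin k)), x = y →
            ∀ v : V, x.2 (Quotient.mk _ v) = y.2 (Quotient.mk _ v) := by
          rintro x _ rfl v; rfl
        ext v : 1
        exact key _ _ h v
      · rintro ⟨⟨r, hr⟩, f⟩
        have hker : Setoid.ker (fun v => f (Quotient.mk r v)) = r := by
          ext u v
          rw [Setoid.ker_def]
          exact ⟨fun h => Quotient.exact (f.injective h), fun h => congrArg f (Quotient.sound h)⟩
        refine ⟨SimpleGraph.Coloring.mk (fun v => f (Quotient.mk r v))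
          (fun {u v} h he => hr u v h (Quotient.exact (f.injective he))), ?_⟩
        have gen : ∀ (r' : Setoid V) (hr' : ∀ u v, G.Adj u v → ¬ r' u v)
            (f' : Quotient r' ↪ Fin k), r' = r →
            (∀ v, f' (Quotient.mk _ v) = f (Quotient.mk _ v)) →
            (⟨⟨r', hr'⟩, f'⟩ : Σ r : I, (Quotient r.1 ↪ Fin k)) = ⟨⟨r, hr⟩, f⟩ := by
          rintro r' hr' f' rfl h
          congr 1
          ext q : 1
          induction q using Quotient.inductionOn with
          | h v => exact h v
        exact gen _ _ _ hker (fun v => rfl))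
  rw [Nat.card_congr e, Nat.card_eq_fintype_card, Fintype.card_sigma, Polynomial.eval_finsetSum]
  push_cast
  refine Finset.sum_congr rfl fun r _ => ?_
  rw [descPochhammer_eval_eq_descFactorial, Fintype.card_embedding_eq, Fintype.card_fin]

/-- There is exactly one complex polynomial whose value at each positive integer `k` is the number
of proper colorings of the finite graph `G` with `k` colors. -/
theorem existsUnique_chromaticPolynomial {V : Type*} [Finite V] (G : SimpleGraph V) :
    ∃! P : Polynomial ℂ, ∀ k : ℕ, 1 ≤ k →
      P.eval (k : ℂ) = (Nat.card (G.Coloring (Fin k)) : ℂ) := by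
  obtain ⟨P, hP⟩ := exists_polynomial_eval_eq_card_coloring G
  refine ⟨P, fun k _ => hP k, fun Q hQ => ?_⟩
  refine Polynomial.eq_of_infinite_eval_eq Q P ?_
  refine ((Set.Ici_infinite (1 : ℕ)).image (Nat.cast_injective (R := ℂ)).injOn).mono ?_
  rintro _ ⟨k, hk, rfl⟩
  exact (hQ k hk).trans (hP k).symm

/-- The chromatic polynomial of a finite graph `G`, as a polynomial over `ℂ`: the unique polynomial
whose value at each integer `k ≥ 1` is the number of proper colorings of `G` with `k` colors. -/
noncomputable def chromaticPolynomial {V : Type*} [Finite V] (G : SimpleGraph V) : Polynomial ℂ :=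
  (existsUnique_chromaticPolynomial G).choose

theorem chromaticPolynomial_eval {V : Type*} [Finite V] (G : SimpleGraph V) (k : ℕ) (hk : 1 ≤ k) :
    (chromaticPolynomial G).eval (k : ℂ) = (Nat.card (G.Coloring (Fin k)) : ℂ) :=
  (existsUnique_chromaticPolynomial G).choose_spec.1 k hk

/-- The chromatic roots of a finite graph: the complex zeros of its chromatic polynomial. -/
def chromaticRoots {V : Type*} [Finite V] (G : SimpleGraph V) : Set ℂ :=
  {q : ℂ | (chromaticPolynomial G).IsRoot q}

/-- The vertices of the generalized theta graph made of `p` chains of `s` edges each: two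
endvertices `x = Sum.inl false` and `y = Sum.inl true`, and `s - 1` inner vertices on each of
the `p` chains. -/
abbrev ThetaVertex (s p : ℕ) : Type := Bool ⊕ (Fin p × Fin (s - 1))

/-- The vertex in position `j` (`0 ≤ j ≤ s`) on the `i`-th chain from `x` to `y`: it is `x` for
`j = 0`, the `j`-th inner vertex of the chain for `0 < j < s`, and `y` for `j = s`. -/
def thetaChain (s p : ℕ) (i : Fin p) (j : ℕ) : ThetaVertex s p :=
  if _h0 : j = 0 then Sum.inl false
  else if hs : j < s then Sum.inr (i, ⟨j - 1, by omega⟩)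
  else Sum.inl true

/-- The generalized theta graph `Θ^{(s,p)}`: endvertices `x`, `y` joined by `p` internally disjoint
paths of length `s`. Its edges join consecutive positions on the same chain. (For `s ≥ 2` the graph
obtained by connecting the chains in parallel has neither loops nor multiple edges.) -/
def thetaGraph (s p : ℕ) : SimpleGraph (ThetaVertex s p) :=
  SimpleGraph.fromRel fun u v =>
    ∃ i : Fin p, ∃ j : ℕ, j < s ∧ u = thetaChain s p i j ∧ v = thetaChain s p i (j + 1)

/-- The join of two graphs: their disjoint union, together with all edges between the two parts. -/
def graphJoin {V W : Type*} (G : SimpleGraph V) (H : SimpleGraph W) : SimpleGraph (V ⊕ W) :=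
  (G ⊕g H) ⊔ completeBipartiteGraph V W

/-- The join of the generalized theta graph `Θ^{(s,p)}` with the complete graph `K₂`. -/
def thetaJoinK2 (s p : ℕ) : SimpleGraph (ThetaVertex s p ⊕ Fin 2) :=
  graphJoin (thetaGraph s p) ((⊤ : SimpleGraph (Fin 2)))

/-! With the end colors fixed, the chains of a theta graph are colored independently, which gives a
closed formula for the chromatic polynomial. In the variable `w = 1 - q`, with `w ≠ 1`, its
vanishing follows from `f(w) ^ p = w`, where `f(w) = (w ^ s - w) / (w ^ s - 1)`
(`mem_chromaticRoots_thetaGraph`).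

As `p` grows, solutions accumulate at every point of the curve `|f| = 1` with `|w| > 1`, by a
quantitative open mapping argument for logarithms (`exists_pow_eq_mul_pow`). As `s` grows, these
curves come close to every point with `|w| > 1`, because `w ^ s` turns quickly
(`exists_norm_pow_sub_eq`). So the roots of theta graphs are dense in `|q - 1| > 1`.

Joining with `K₂` shifts roots by `2`, so the joins cover `|q - 3| > 1`. The two excluded disks
share only the point `2`, which density ignores. -/

/-! ### Counting colorings of chains and theta graphs -/

/-- The sequence of colors along a chain with end colors `a`, `b` and inner colors `f`. -/
def chainSeq {α : Type*} {m : ℕ} (a b : α) (f : Fin m → α) (j : ℕ) : α :=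
  if j = 0 then a else if h : j - 1 < m then f ⟨j - 1, h⟩ else b

/-- The proper colorings of the inner vertices of a chain whose end colors are `a` and `b`. -/
abbrev ChainColoring {α : Type*} (m : ℕ) (a b : α) : Type _ :=
  {f : Fin m → α // ∀ j < m + 1, chainSeq a b f j ≠ chainSeq a b f (j + 1)}

theorem chainSeq_cons {α : Type*} {m : ℕ} (a b c : α) (f : Fin m → α) (j : ℕ) :
    chainSeq a b (Fin.cons c f : Fin (m + 1) → α) (j + 1) = chainSeq c b f j := by
  cases j with
  | zero => simp [chainSeq]
  | succ j =>
    unfold chainSeq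
    rw [if_neg (by omega), if_neg (by omega)]
    by_cases h : j < m
    · rw [dif_pos (show j + 1 + 1 - 1 < m + 1 by omega), dif_pos (show j + 1 - 1 < m by omega)]
      rfl
    · rw [dif_neg (by omega), dif_neg (by omega)]

/-- The first inner color of a chain differs from the end color `a`; the rest is a shorter chain. -/
def chainColoringSuccEquiv {α : Type*} (m : ℕ) (a b : α) :
    ChainColoring (m + 1) a b ≃ Σ c : {c : α // c ≠ a}, ChainColoring m c.1 b where
  toFun f := ⟨⟨f.1 0, by
      have h := f.2 0 (by omega)
      rw [← Fin.cons_self_tail f.1, chainSeq_cons] at h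
      simpa [chainSeq] using h.symm⟩, ⟨Fin.tail f.1, fun j hj => by
      have h := f.2 (j + 1) (by omega)
      rwa [← Fin.cons_self_tail f.1, chainSeq_cons, chainSeq_cons] at h⟩⟩
  invFun g := ⟨Fin.cons g.1.1 g.2.1, fun j hj => by
      cases j with
      | zero =>
        rw [chainSeq_cons]
        simpa [chainSeq] using g.1.2.symm
      | succ j =>
        rw [chainSeq_cons, chainSeq_cons]
        exact g.2.2 j (by omega)⟩
  left_inv f := Subtype.ext (Fin.cons_self_tail f.1)
  right_inv g := rfl

/-- These are entries of powers of the adjacency matrix of the complete graph on the colors, whose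
eigenvalues are `card α - 1` and `-1`. The factor `card α` avoids division. -/
theorem card_mul_card_chainColoring {α : Type*} [Fintype α] [DecidableEq α] (m : ℕ) (a b : α) :
    (Fintype.card α : ℂ) * (Nat.card (ChainColoring m a b) : ℂ) =
      ((Fintype.card α : ℂ) - 1) ^ (m + 1) +
        (if a = b then (Fintype.card α : ℂ) - 1 else -1) * (-1) ^ (m + 1) := by
  induction m generalizing a with
  | zero =>
    by_cases h : a = b
    · have : IsEmpty (ChainColoring 0 a b) := ⟨fun f => f.2 0 (by omega) (by simp [chainSeq, h])⟩
      rw [Nat.card_of_isEmpty, if_pos h]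
      push_cast
      ring
    · have : Unique (ChainColoring 0 a b) :=
        { default := ⟨Fin.elim0, fun j hj => by
            obtain rfl : j = 0 := by omega
            simpa [chainSeq] using h⟩
          uniq := fun f => Subtype.ext (Subsingleton.elim _ _) }
      simp [h]
  | succ m ih =>
    rw [Nat.card_congr (chainColoringSuccEquiv m a b), Nat.card_sigma]
    push_cast
    rw [Finset.mul_sum]
    simp only [ih]
    rw [← Finset.sum_subtype (Finset.univ.erase a) (by simp) (fun c =>
      ((Fintype.card α : ℂ) - 1) ^ (m + 1) +
        (if c = b then (Fintype.card α : ℂ) - 1 else -1) * (-1) ^ (m + 1))]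
    -- This vector is orthogonal to the constants, so summing it over `c ≠ a` gives minus its value
    -- at `a`: the eigenvalue `-1`.
    have h0 : ∑ c : α, (if c = b then (Fintype.card α : ℂ) - 1 else -1) = 0 := by
      have : ∀ c : α, (if c = b then (Fintype.card α : ℂ) - 1 else -1) =
          (if c = b then (Fintype.card α : ℂ) else 0) - 1 := fun c => by split_ifs <;> ring
      simp [this]
    rw [← Finset.sum_erase_add _ _ (Finset.mem_univ a)] at h0
    rw [Finset.sum_add_distrib, ← Finset.sum_mul, eq_neg_of_add_eq_zero_left h0, Finset.sum_const,
      Finset.card_erase_of_mem (Finset.mem_univ a), nsmul_eq_mul, Finset.card_univ,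
      Nat.cast_sub (Fintype.card_pos_iff.2 ⟨a⟩)]
    push_cast
    ring

theorem thetaChain_ne_succ {s p : ℕ} (i : Fin p) {j : ℕ} (hj : j < s) :
    thetaChain s p i j ≠ thetaChain s p i (j + 1) := by
  unfold thetaChain
  split_ifs <;> simp <;> omega

theorem thetaGraph_coloring_ne {s p : ℕ} {α : Type*} (c : (thetaGraph s p).Coloring α)
    (i : Fin p) {j : ℕ} (hj : j < s) : c (thetaChain s p i j) ≠ c (thetaChain s p i (j + 1)) :=
  c.valid ((SimpleGraph.fromRel_adj _ _ _).2
    ⟨thetaChain_ne_succ i hj, Or.inl ⟨i, j, hj, rfl, rfl⟩⟩)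

theorem apply_thetaChain {m p : ℕ} {α : Type*} (c : ThetaVertex (m + 1) p → α) (i : Fin p)
    (j : ℕ) : c (thetaChain (m + 1) p i j) =
      chainSeq (c (Sum.inl false)) (c (Sum.inl true)) (fun l : Fin m => c (Sum.inr (i, l))) j := by
  unfold thetaChain chainSeq
  split_ifs <;> first | rfl | omega

/-- A proper coloring of the theta graph amounts to colors of the endvertices and proper
colorings of the chains. -/
def thetaGraphColoringEquiv (m p : ℕ) (α : Type*) :
    (thetaGraph (m + 1) p).Coloring α ≃ Σ e : α × α, (Fin p → ChainColoring m e.1 e.2) where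
  toFun c := ⟨(c (Sum.inl false), c (Sum.inl true)), fun i => ⟨fun l => c (Sum.inr (i, l)),
    fun j hj => by
      have := thetaGraph_coloring_ne c i hj
      rwa [apply_thetaChain (m := m) c, apply_thetaChain (m := m) c] at this⟩⟩
  invFun F := SimpleGraph.Coloring.mk
    (Sum.elim (fun t => if t then F.1.2 else F.1.1) (fun x => (F.2 x.1).1 x.2)) (by
      have key : ∀ (i : Fin p) (j : ℕ), j < m + 1 →
          Sum.elim (fun t => if t then F.1.2 else F.1.1)
            (fun x : Fin p × Fin m => (F.2 x.1).1 x.2) (thetaChain (m + 1) p i j) ≠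
          Sum.elim (fun t => if t then F.1.2 else F.1.1)
            (fun x : Fin p × Fin m => (F.2 x.1).1 x.2) (thetaChain (m + 1) p i (j + 1)) := by
        intro i j hj
        rw [apply_thetaChain (m := m) (Sum.elim _ _), apply_thetaChain (m := m) (Sum.elim _ _)]
        exact (F.2 i).2 j hj
      intro u v h
      obtain ⟨-, ⟨i, j, hj, rfl, rfl⟩ | ⟨i, j, hj, rfl, rfl⟩⟩ :=
        (SimpleGraph.fromRel_adj _ _ _).1 h
      · exact key i j hj
      · exact (key i j hj).symm)
  left_inv c := by
    ext v : 1
    rcases v with (_ | _) | _ <;> rfl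
  right_inv F := rfl

/-- The two terms come from equal and from distinct end colors; each of the `p` chains absorbs one
factor `card α`. -/
theorem card_pow_mul_card_thetaGraph_coloring (m p : ℕ) (α : Type*) [Fintype α] :
    (Fintype.card α : ℂ) ^ p * (Nat.card ((thetaGraph (m + 1) p).Coloring α) : ℂ) =
      Fintype.card α * (((Fintype.card α : ℂ) - 1) ^ (m + 1) +
          ((Fintype.card α : ℂ) - 1) * (-1) ^ (m + 1)) ^ p +
        Fintype.card α * ((Fintype.card α : ℂ) - 1) *
          (((Fintype.card α : ℂ) - 1) ^ (m + 1) - (-1) ^ (m + 1)) ^ p := by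
  classical
  rw [Nat.card_congr (thetaGraphColoringEquiv m p α), Nat.card_sigma]
  simp only [Nat.card_fun, Nat.card_eq_fintype_card (α := Fin p), Fintype.card_fin]
  push_cast
  rw [Finset.mul_sum]
  simp only [← mul_pow, card_mul_card_chainColoring]
  rw [Fintype.sum_prod_type]
  have h : ∀ a : α, ∑ b : α, (((Fintype.card α : ℂ) - 1) ^ (m + 1) +
        (if a = b then (Fintype.card α : ℂ) - 1 else -1) * (-1) ^ (m + 1)) ^ p =
      (((Fintype.card α : ℂ) - 1) ^ (m + 1) +
          ((Fintype.card α : ℂ) - 1) * (-1) ^ (m + 1)) ^ p +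
        ((Fintype.card α : ℂ) - 1) *
          (((Fintype.card α : ℂ) - 1) ^ (m + 1) - (-1) ^ (m + 1)) ^ p := by
    intro a
    rw [← Finset.add_sum_erase _ _ (Finset.mem_univ a), if_pos rfl]
    congr 1
    rw [Finset.sum_congr rfl (g := fun _ => (((Fintype.card α : ℂ) - 1) ^ (m + 1) -
      (-1) ^ (m + 1)) ^ p)]
    · rw [Finset.sum_const, Finset.card_erase_of_mem (Finset.mem_univ a), nsmul_eq_mul,
        Finset.card_univ, Nat.cast_sub (Fintype.card_pos_iff.2 ⟨a⟩)]
      push_cast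
      ring
    · intro b hb
      rw [if_neg (Finset.ne_of_mem_erase hb).symm]
      ring
  rw [Finset.sum_congr rfl (fun a _ => h a), Finset.sum_const, nsmul_eq_mul, Finset.card_univ]
  ring

/-! ### From coloring counts to chromatic roots -/

theorem Polynomial.eq_of_eval_natCast_eq (P Q : Polynomial ℂ) (N : ℕ)
    (h : ∀ k : ℕ, N ≤ k → P.eval (k : ℂ) = Q.eval (k : ℂ)) : P = Q := by
  refine Polynomial.eq_of_infinite_eval_eq P Q ?_
  refine ((Set.Ici_infinite N).image (Nat.cast_injective (R := ℂ)).injOn).mono ?_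
  rintro _ ⟨k, hk, rfl⟩
  exact h k hk

theorem chromaticPolynomial_thetaGraph {s : ℕ} (hs : 1 ≤ s) (p : ℕ) (q : ℂ) :
    q ^ p * (chromaticPolynomial (thetaGraph s p)).eval q =
      q * ((q - 1) ^ s + (q - 1) * (-1) ^ s) ^ p +
        q * (q - 1) * ((q - 1) ^ s - (-1) ^ s) ^ p := by
  obtain ⟨m, rfl⟩ := Nat.exists_eq_add_of_le' hs
  have h := Polynomial.eq_of_eval_natCast_eq
    (.X ^ p * chromaticPolynomial (thetaGraph (m + 1) p))
    (.X * ((.X - 1) ^ (m + 1) + (.X - 1) * (-1) ^ (m + 1)) ^ p +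
        .X * (.X - 1) * ((.X - 1) ^ (m + 1) - (-1) ^ (m + 1)) ^ p) 1 (fun k hk => by
      have := card_pow_mul_card_thetaGraph_coloring m p (Fin k)
      simp only [Fintype.card_fin] at this
      simpa [chromaticPolynomial_eval _ k hk] using this)
  simpa using congrArg (Polynomial.eval q) h

/-- With `q = 1 - w` the signs factor out as `(-1) ^ (s * p)` and the two terms of the formula
cancel. The condition `w ≠ 1` allows division by `q ^ p`. -/
theorem mem_chromaticRoots_thetaGraph {s : ℕ} (hs : 1 ≤ s) (p : ℕ) {w : ℂ} (hw : w ≠ 1)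
    (h : (w ^ s - w) ^ p = w * (w ^ s - 1) ^ p) : 1 - w ∈ chromaticRoots (thetaGraph s p) := by
  have h1 : (1 - w) ≠ 0 := sub_ne_zero.2 hw.symm
  have e := chromaticPolynomial_thetaGraph hs p (1 - w)
  have h2 : (1 - w - 1 : ℂ) = -1 * w := by ring
  rw [h2, mul_pow, show ((-1 : ℂ)) ^ s * w ^ s + -1 * w * (-1) ^ s = (-1) ^ s * (w ^ s - w) by ring,
    show ((-1 : ℂ)) ^ s * w ^ s - (-1) ^ s = (-1) ^ s * (w ^ s - 1) by ring, mul_pow, mul_pow, h,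
    show (1 - w) * (((-1 : ℂ) ^ s) ^ p * (w * (w ^ s - 1) ^ p)) +
      (1 - w) * (-1 * w) * (((-1) ^ s) ^ p * (w ^ s - 1) ^ p) = 0 by ring] at e
  exact (mul_eq_zero.1 e).resolve_left (pow_ne_zero _ h1)

/-! ### Isomorphism invariance and joins with `K₂` -/

/-- Isomorphic graphs have equally many colorings by equinumerous sets of colors. -/
def SimpleGraph.Coloring.congr {V W α β : Type*} {G : SimpleGraph V} {H : SimpleGraph W}
    (e : G ≃g H) (f : α ≃ β) : G.Coloring α ≃ H.Coloring β where
  toFun c := SimpleGraph.Coloring.mk (fun v => f (c (e.symm v))) (fun h he =>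
    c.valid (e.symm.map_rel_iff.2 h) (f.injective he))
  invFun c := SimpleGraph.Coloring.mk (fun v => f.symm (c (e v))) (fun h he =>
    c.valid (e.map_rel_iff.2 h) (f.symm.injective he))
  left_inv c := by
    ext v : 1
    change f.symm (f (c (e.symm (e v)))) = c v
    simp
  right_inv c := by
    ext v : 1
    change f (f.symm (c (e (e.symm v)))) = c v
    simp

theorem chromaticRoots_congr {V W : Type*} [Finite V] [Finite W] {G : SimpleGraph V}
    {H : SimpleGraph W} (e : G ≃g H) : chromaticRoots G = chromaticRoots H := by
  have : chromaticPolynomial G = chromaticPolynomial H :=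
    Polynomial.eq_of_eval_natCast_eq _ _ 1 fun k hk => by
      rw [chromaticPolynomial_eval _ k hk, chromaticPolynomial_eval _ k hk,
        Nat.card_congr (SimpleGraph.Coloring.congr e (Equiv.refl _))]
  rw [chromaticRoots, chromaticRoots, this]

/-- A proper coloring of the join of `G` with a complete graph colors the complete graph
injectively, and `G` with the remaining colors. -/
def graphJoinTopColoringEquiv {V W : Type*} (G : SimpleGraph V) (α : Type*) :
    (graphJoin G (⊤ : SimpleGraph W)).Coloring α ≃
      Σ e : W ↪ α, G.Coloring {c : α // c ∉ Set.range e} where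
  toFun c := ⟨⟨fun i => c (Sum.inr i), fun i j h => by
      by_contra hij
      exact c.valid (v := Sum.inr i) (w := Sum.inr j) (by simpa [graphJoin] using hij) h⟩,
    SimpleGraph.Coloring.mk (fun v => ⟨c (Sum.inl v), by
      rintro ⟨i, hi⟩
      exact c.valid (v := Sum.inr i) (w := Sum.inl v) (by simp [graphJoin]) hi⟩)
      (fun {u v} h he => c.valid (v := Sum.inl u) (w := Sum.inl v) (by simpa [graphJoin] using h)
        (congrArg Subtype.val he))⟩
  invFun F := SimpleGraph.Coloring.mk (Sum.elim (fun v => (F.2 v).1) F.1) (by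
    rintro (u | i) (v | j) h
    · exact fun he => F.2.valid (by simpa [graphJoin] using h) (Subtype.ext he)
    · exact fun he => (F.2 u).2 ⟨j, he.symm⟩
    · exact fun he => (F.2 v).2 ⟨i, he⟩
    · exact fun he => absurd (F.1.injective he) (by simpa [graphJoin] using h))
  left_inv c := by
    ext v : 1
    rcases v with _ | _ <;> rfl
  right_inv F := rfl

theorem card_graphJoin_top_coloring {V : Type*} [Finite V] (G : SimpleGraph V) (k : ℕ) :
    Nat.card ((graphJoin G (⊤ : SimpleGraph (Fin 2))).Coloring (Fin (k + 2))) =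
      (k + 2) * (k + 1) * Nat.card (G.Coloring (Fin k)) := by
  classical
  have hfin : ∀ β : Type, Finite β → Finite (G.Coloring β) := fun β _ => DFunLike.finite _
  have := fun β => hfin β
  rw [Nat.card_congr (graphJoinTopColoringEquiv G _), Nat.card_sigma,
    Finset.sum_congr rfl (g := fun _ => Nat.card (G.Coloring (Fin k)))]
  · rw [Finset.sum_const, Finset.card_univ, Fintype.card_embedding_eq]
    simp [Nat.descFactorial, mul_comm]
  · intro e _
    refine Nat.card_congr (SimpleGraph.Coloring.congr SimpleGraph.Iso.refl
      (Fintype.equivFinOfCardEq ?_))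
    rw [Fintype.card_subtype_compl, Fintype.card_fin, Set.card_range_of_injective e.injective]
    simp

/-- The count for the join gives `P_{G+K₂}(q + 2) = (q + 2) (q + 1) P_G(q)`. -/
theorem mem_chromaticRoots_graphJoin_top {V : Type*} [Finite V] (G : SimpleGraph V) {q : ℂ}
    (hq : q ∈ chromaticRoots G) :
    q + 2 ∈ chromaticRoots (graphJoin G (⊤ : SimpleGraph (Fin 2))) := by
  have h := Polynomial.eq_of_eval_natCast_eq
    ((chromaticPolynomial (graphJoin G (⊤ : SimpleGraph (Fin 2)))).comp (.X + 2))
    ((.X + 2) * (.X + 1) * chromaticPolynomial G) 1 (fun k hk => by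
      have h1 := chromaticPolynomial_eval (graphJoin G (⊤ : SimpleGraph (Fin 2))) (k + 2) (by omega)
      rw [card_graphJoin_top_coloring] at h1
      push_cast at h1
      simpa [chromaticPolynomial_eval G k hk] using h1)
  have h2 := congrArg (Polynomial.eval q) h
  have h3 : (chromaticPolynomial G).eval q = 0 := hq
  change Polynomial.eval (q + 2) _ = 0
  simpa [h3] using h2

/-! ### Limiting curves and accumulation of roots -/

open Filter Topology Metric

/-- Near every point outside the closed unit disk, the limiting curves `|w ^ s - w| = |w ^ s - 1|`
pass, for large `s`. -/
theorem exists_norm_pow_sub_eq {w₀ : ℂ} (hw₀ : 1 < ‖w₀‖) {ε : ℝ} (hε : 0 < ε) :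
    ∃ s : ℕ, 2 ≤ s ∧ ∃ w : ℂ, ‖w - w₀‖ < ε ∧ ‖w‖ = ‖w₀‖ ∧ ‖w ^ s - w‖ = ‖w ^ s - 1‖ := by
  have hw1 : 0 < ‖w₀ - 1‖ := norm_pos_iff.2 (sub_ne_zero.2 (by rintro rfl; simp at hw₀))
  have hr : 0 < ‖w₀‖ := by linarith
  -- The first bound makes the oscillating term `‖c‖` below exceed `‖w₀‖ ^ 2 - 1`; the second keeps
  -- rotations of `w₀` by angles up to `2π / s` within `ε` and `‖w₀ - 1‖ / 2` of `w₀`.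
  obtain ⟨s, hs2, hsp, hsN⟩ : ∃ s : ℕ, 2 ≤ s ∧ (‖w₀‖ ^ 2 - 1) / ‖w₀ - 1‖ < ‖w₀‖ ^ s ∧
      ‖w₀‖ * (2 * Real.pi) / min ε (‖w₀ - 1‖ / 2) < s :=
    ((eventually_ge_atTop 2).and (((tendsto_pow_atTop_atTop_of_one_lt hw₀).eventually_gt_atTop _).and
      (tendsto_natCast_atTop_atTop.eventually_gt_atTop _))).exists
  have hs0 : (0 : ℝ) < s := by positivity
  rw [div_lt_iff₀ hw1] at hsp
  rw [div_lt_comm₀ (by positivity) hs0] at hsN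
  have hsε := hsN.trans_le (min_le_left _ _)
  have hs1 := hsN.trans_le (min_le_right _ _)
  let γ : ℝ → ℂ := fun t => w₀ * Complex.exp (Complex.I * (t / s : ℝ))
  have hγn : ∀ t, ‖γ t‖ = ‖w₀‖ := fun t => by
    rw [norm_mul, Complex.norm_exp_I_mul_ofReal, mul_one]
  have hγp : ∀ t, γ t ^ s = w₀ ^ s * Complex.exp (t * Complex.I) := fun t => by
    rw [mul_pow, ← Complex.exp_nat_mul]
    congr 2
    have : (s : ℂ) ≠ 0 := by exact_mod_cast hs0.ne'
    push_cast
    field_simp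
  have hγd : ∀ t, |t| ≤ 2 * Real.pi → ‖γ t - w₀‖ ≤ ‖w₀‖ * (2 * Real.pi) / s := fun t ht => by
    have : γ t - w₀ = w₀ * (Complex.exp (Complex.I * (t / s : ℝ)) - 1) := by ring
    rw [this, norm_mul, mul_div_assoc]
    refine mul_le_mul_of_nonneg_left ((Real.norm_exp_I_mul_ofReal_sub_one_le).trans ?_) hr.le
    rw [Real.norm_eq_abs, abs_div, abs_of_pos hs0]
    gcongr
  have hid : ∀ z w : ℂ, ‖z - w‖ ^ 2 - ‖z - 1‖ ^ 2 =
      ‖w‖ ^ 2 - 1 - 2 * (z * (starRingEnd ℂ w - 1)).re := fun z w => by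
    simp only [Complex.sq_norm, Complex.normSq_apply]
    simp
    ring
  set c : ℂ := w₀ ^ s * (starRingEnd ℂ w₀ - 1) with hc
  have hcn : ‖c‖ = ‖w₀‖ ^ s * ‖w₀ - 1‖ := by
    rw [hc, norm_mul, norm_pow, ← Complex.norm_conj (w₀ - 1), map_sub, map_one]
  -- Freezing the slow factor at `w₀` leaves a pure rotation of `c`, at a cost of at most half its
  -- amplitude.
  have hre : ∀ t, |t| ≤ 2 * Real.pi → |(γ t ^ s * (starRingEnd ℂ (γ t) - 1)).re -
      (c * Complex.exp (t * Complex.I)).re| ≤ ‖c‖ / 2 := fun t ht => by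
    rw [← Complex.sub_re]
    refine (Complex.abs_re_le_norm _).trans ?_
    have : γ t ^ s * (starRingEnd ℂ (γ t) - 1) - c * Complex.exp (t * Complex.I) =
        γ t ^ s * starRingEnd ℂ (γ t - w₀) := by
      rw [hγp, hc, map_sub]
      ring
    rw [this, norm_mul, norm_pow, hγn, Complex.norm_conj, hcn, mul_div_assoc]
    exact mul_le_mul_of_nonneg_left ((hγd t ht).trans hs1.le) (by positivity)
  have hpi := Real.pi_pos
  have harg := abs_le.1 (Complex.abs_arg_le_pi c)
  have hb1 : ∀ t ∈ Set.Icc (-c.arg) (-c.arg + Real.pi), |t| ≤ 2 * Real.pi := fun t ht =>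
    abs_le.2 ⟨by linarith [ht.1], by linarith [ht.2]⟩
  have hm1 : -c.arg ∈ Set.Icc (-c.arg) (-c.arg + Real.pi) := ⟨le_rfl, by linarith⟩
  have hm2 : -c.arg + Real.pi ∈ Set.Icc (-c.arg) (-c.arg + Real.pi) := ⟨by linarith, le_rfl⟩
  have hv1 : c * Complex.exp ((-c.arg : ℝ) * Complex.I) = (‖c‖ : ℝ) := by
    nth_rw 1 [← Complex.norm_mul_exp_arg_mul_I c]
    rw [mul_assoc, ← Complex.exp_add]
    push_cast
    rw [neg_mul, add_neg_cancel, Complex.exp_zero, mul_one]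
  have hv2 : c * Complex.exp ((-c.arg + Real.pi : ℝ) * Complex.I) = (-‖c‖ : ℝ) := by
    rw [Complex.ofReal_add, add_mul, Complex.exp_add, ← mul_assoc, hv1, Complex.exp_pi_mul_I]
    simp
  have hF1 := hid (γ (-c.arg) ^ s) (γ (-c.arg))
  have hF2 := hid (γ (-c.arg + Real.pi) ^ s) (γ (-c.arg + Real.pi))
  have hr1 := abs_le.1 (hre _ (hb1 _ hm1))
  have hr2 := abs_le.1 (hre _ (hb1 _ hm2))
  rw [hv1, Complex.ofReal_re] at hr1
  rw [hv2, Complex.ofReal_re] at hr2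
  rw [hγn] at hF1 hF2
  rw [← hcn] at hsp
  have hw2 : 1 < ‖w₀‖ ^ 2 := one_lt_pow₀ hw₀ two_ne_zero
  -- At the two ends the rotated `c` is `‖c‖` and `-‖c‖`, so the difference of squares is at most
  -- `‖w₀‖ ^ 2 - 1 - ‖c‖ < 0` and at least `‖w₀‖ ^ 2 - 1 + ‖c‖ > 0`.
  obtain ⟨t, ht, h0⟩ := intermediate_value_Icc (show -c.arg ≤ -c.arg + Real.pi by linarith)
    (f := fun t => ‖γ t ^ s - γ t‖ ^ 2 - ‖γ t ^ s - 1‖ ^ 2)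
    (Continuous.continuousOn (by fun_prop)) (show (0 : ℝ) ∈ Set.Icc _ _ from
      ⟨by linarith [hr1.1], by linarith [hr2.2, norm_nonneg c]⟩)
  refine ⟨s, hs2, γ t, (hγd t (hb1 t ht)).trans_lt hsε, hγn t, ?_⟩
  exact (pow_left_inj₀ (norm_nonneg _) (norm_nonneg _) two_ne_zero).1 (sub_eq_zero.1 h0)

/-- For large `p` the equation `(w ^ s - w) ^ p = w * (w ^ s - 1) ^ p` has a solution near any point
of the limiting curve. -/
theorem exists_pow_eq_mul_pow {s : ℕ} (hs : 2 ≤ s) {w₁ : ℂ} (h₁ : 1 < ‖w₁‖)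
    (h : ‖w₁ ^ s - w₁‖ = ‖w₁ ^ s - 1‖) {ε : ℝ} (hε : 0 < ε) :
    ∃ p : ℕ, 1 ≤ p ∧ ∃ w : ℂ, ‖w - w₁‖ < ε ∧ (w ^ s - w) ^ p = w * (w ^ s - 1) ^ p := by
  have hw₁ : w₁ ≠ 0 := by rintro rfl; simp at h₁; linarith
  have hne : w₁ ^ s - 1 ≠ 0 := by
    intro h0
    have := congrArg norm (sub_eq_zero.1 h0)
    rw [norm_pow, norm_one] at this
    exact (one_lt_pow₀ h₁ (by omega)).ne' this
  set f : ℂ → ℂ := fun w => (w ^ s - w) / (w ^ s - 1) with hf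
  set u := f w₁ with hu
  have hun : ‖u‖ = 1 := by
    rw [hu, hf]
    simp only [norm_div, h]
    exact div_self (norm_ne_zero_iff.2 hne)
  have hu0 : u ≠ 0 := by rw [← norm_ne_zero_iff, hun]; exact one_ne_zero
  have hfd : DifferentiableAt ℂ f w₁ := by
    apply DifferentiableAt.div <;> first | fun_prop | exact hne
  have hfc : ∀ w, w ^ s - 1 ≠ 0 → DifferentiableAt ℂ f w := fun w hw => by
    apply DifferentiableAt.div <;> first | fun_prop | exact hw
  -- `f` takes the value `u` only finitely often
  have hfin : ∀ᶠ w in 𝓝[≠] w₁, w ^ s - w - u * (w ^ s - 1) ≠ 0 := by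
    set Q : Polynomial ℂ := .X ^ s - .X - .C u * (.X ^ s - 1) with hQ
    -- Since `s ≥ 2`, the coefficient of `X` is `-1`.
    have hQ0 : Q ≠ 0 := by
      intro h0
      have := congrArg (fun P => Polynomial.coeff P 1) h0
      simp [hQ, Polynomial.coeff_X_pow, Polynomial.coeff_one, show 1 ≠ s by omega] at this
    have : IsClosed {w | w ≠ w₁ ∧ w ^ s - w - u * (w ^ s - 1) = 0} :=
      ((Polynomial.finite_setOfPred_isRoot hQ0).subset fun w hw => by
        simpa [hQ] using hw.2).isClosed
    rw [eventually_nhdsWithin_iff]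
    filter_upwards [this.isOpen_compl.mem_nhds (x := w₁) (by simp)] with w hw hw' h0
    exact hw ⟨hw', h0⟩
  have e1 : ∀ᶠ w in 𝓝 w₁, w ^ s - 1 ≠ 0 :=
    ContinuousAt.eventually_ne (g := fun w : ℂ => w ^ s - 1) (by fun_prop) hne
  have e2 : ∀ᶠ w in 𝓝 w₁, f w / u ∈ Complex.slitPlane :=
    (hfd.continuousAt.div_const u).eventually_mem (Complex.isOpen_slitPlane.mem_nhds (by
      rw [← hu, div_self hu0]; simp))
  have e3 : ∀ᶠ w in 𝓝 w₁, w / w₁ ∈ Complex.slitPlane :=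
    ContinuousAt.eventually_mem (f := fun w : ℂ => w / w₁) (by fun_prop)
      (Complex.isOpen_slitPlane.mem_nhds (by rw [div_self hw₁]; simp))
  obtain ⟨r, hr, hrε⟩ : ∃ r > 0, ∀ w, dist w w₁ < r → (w ^ s - 1 ≠ 0 ∧ f w / u ∈ Complex.slitPlane ∧
      w / w₁ ∈ Complex.slitPlane ∧ (w ≠ w₁ → w ^ s - w - u * (w ^ s - 1) ≠ 0)) :=
    Metric.eventually_nhds_iff.1 (e1.and (e2.and (e3.and (eventually_nhdsWithin_iff.1 hfin))))
  set δ := min r ε / 2 with hδ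
  have hδ0 : 0 < δ := by positivity
  have hδr : δ < r := by have := min_le_left r ε; have : 0 < min r ε := by positivity
                         linarith
  have hδε : δ < ε := by have := min_le_right r ε; have : 0 < min r ε := by positivity
                         linarith
  have hball : ∀ w ∈ closedBall w₁ δ, dist w w₁ < r := fun w hw => (mem_closedBall.1 hw).trans_lt hδr
  set g : ℂ → ℂ := fun w => Complex.log (f w / u) with hg
  set l : ℂ → ℂ := fun w => Complex.log (w / w₁) with hl
  have hgd : ∀ w ∈ closedBall w₁ δ, DifferentiableAt ℂ g w := fun w hw =>
    ((hfc w (hrε w (hball w hw)).1).div_const u).clog (hrε w (hball w hw)).2.1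
  have hld : ∀ w ∈ closedBall w₁ δ, DifferentiableAt ℂ l w := fun w hw =>
    (differentiableAt_id.div_const w₁).clog (hrε w (hball w hw)).2.2.1
  have hg0 : g w₁ = 0 := by simp [hg, ← hu, div_self hu0]
  have hl0 : l w₁ = 0 := by simp [hl]
  have hgne : ∀ w ∈ sphere w₁ δ, g w ≠ 0 := by
    intro w hw h0
    have hw' := sphere_subset_closedBall hw
    obtain ⟨a1, a2, -, a4⟩ := hrε w (hball w hw')
    have h1 : f w / u = 1 := by
      rw [← Complex.exp_log (Complex.slitPlane_ne_zero a2)]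
      change Complex.exp (g w) = 1
      rw [h0, Complex.exp_zero]
    rw [div_eq_one_iff_eq hu0] at h1
    refine a4 (by rintro rfl; simp at hw; linarith) ?_
    rw [← h1, hf]
    simp only
    rw [div_mul_cancel₀ _ a1, sub_self]
  obtain ⟨η, hη, hgη⟩ : ∃ η > 0, ∀ w ∈ sphere w₁ δ, η ≤ ‖g w‖ := by
    have hc : ContinuousOn (fun w => ‖g w‖) (sphere w₁ δ) := fun w hw =>
      (hgd w (sphere_subset_closedBall hw)).continuousAt.norm.continuousWithinAt
    obtain ⟨z, hz, hmin⟩ := (isCompact_sphere w₁ δ).exists_isMinOn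
      (NormedSpace.sphere_nonempty.2 hδ0.le) hc
    exact ⟨‖g z‖, norm_pos_iff.2 (hgne z hz), fun w hw => hmin hw⟩
  obtain ⟨M, hM⟩ : ∃ M, ∀ w ∈ sphere w₁ δ, ‖l w‖ ≤ M :=
    (isCompact_sphere w₁ δ).exists_bound_of_continuousOn fun w hw =>
      (hld w (sphere_subset_closedBall hw)).continuousAt.continuousWithinAt
  -- the logarithm of `w₁ / u ^ p` is bounded uniformly in `p`
  have hcb : ∀ p : ℕ, ‖Complex.log (w₁ / u ^ p)‖ ≤ |Real.log ‖w₁‖| + Real.pi := by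
    intro p
    refine (Complex.norm_le_abs_re_add_abs_im _).trans (add_le_add ?_ ?_)
    · rw [Complex.log_re, norm_div, norm_pow, hun, one_pow, div_one]
    · rw [Complex.log_im]
      exact Complex.abs_arg_le_pi _
  -- The first bound makes `l / p` at most `η / 2` on the sphere, so `H` stays at least `η / 2` from
  -- `H w₁` there. The second puts the target value within `η / 4`, the radius that the open mapping
  -- estimate covers.
  obtain ⟨p, hp⟩ := exists_nat_gt
    (max (2 * M / η) (4 * (|Real.log ‖w₁‖| + Real.pi) / η))
  have hp1 := (le_max_left _ _).trans_lt hp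
  have hp2 := (le_max_right _ _).trans_lt hp
  have hp0 : (0 : ℝ) < p := lt_of_le_of_lt (by positivity) hp2
  have hpc : (p : ℂ) ≠ 0 := by exact_mod_cast hp0.ne'
  rw [div_lt_iff₀ hη] at hp1 hp2
  set H : ℂ → ℂ := fun w => g w - l w / p with hH
  have hH0 : H w₁ = 0 := by simp [hH, hg0, hl0]
  have hHs : ∀ w ∈ sphere w₁ δ, η / 2 ≤ ‖H w - H w₁‖ := by
    intro w hw
    rw [hH0, sub_zero]
    have h2 : ‖l w / p‖ ≤ η / 2 := by
      rw [norm_div, Complex.norm_natCast, div_le_iff₀ hp0]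
      linarith [hM w hw]
    have := norm_sub_norm_le (g w) (l w / p)
    have := hgη w hw
    change _ ≤ ‖g w - l w / p‖
    linarith
  have hHd : DiffContOnCl ℂ H (ball w₁ δ) := by
    refine DifferentiableOn.diffContOnCl fun w hw => ?_
    have hw := closure_ball_subset_closedBall hw
    exact ((hgd w hw).sub ((hld w hw).div_const _)).differentiableWithinAt
  -- Otherwise the identity theorem, on the larger ball of radius `r` that contains the sphere,
  -- contradicts `hHs`.
  have hfreq : ∃ᶠ z in 𝓝 w₁, H z ≠ H w₁ := by
    intro hev
    have hev' : ∀ᶠ z in 𝓝 w₁, H z = H w₁ := by simpa using hev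
    have hA : AnalyticOnNhd ℂ H (ball w₁ r) := by
      refine DifferentiableOn.analyticOnNhd (fun w hw => ?_) isOpen_ball
      have hw := hrε w (mem_ball.1 hw)
      exact ((((hfc w hw.1).div_const u).clog hw.2.1).sub
        (((differentiableAt_id.div_const w₁).clog hw.2.2.1).div_const _)).differentiableWithinAt
    have := hA.eqOn_of_preconnected_of_eventuallyEq (analyticOnNhd_const (v := H w₁))
      (convex_ball w₁ r).isPreconnected (mem_ball_self hr) hev'
    obtain ⟨z, hz⟩ := (NormedSpace.sphere_nonempty (x := w₁) (r := δ)).2 hδ0.le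
    have h1 := this (mem_ball.2 (hball z (sphere_subset_closedBall hz)))
    have h2 := hHs z hz
    rw [h1, sub_self, norm_zero] at h2
    linarith
  have hsub := hHd.ball_subset_image_closedBall hδ0 hHs hfreq
  obtain ⟨w, hw, hHw⟩ : Complex.log (w₁ / u ^ p) / p ∈ H '' closedBall w₁ δ := by
    apply hsub
    rw [hH0, mem_ball_zero_iff, norm_div, Complex.norm_natCast, div_lt_iff₀ hp0]
    linarith [hcb p]
  obtain ⟨a1, a2, a3, -⟩ := hrε w (hball w hw)
  refine ⟨p, by exact_mod_cast hp0, w, ?_, ?_⟩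
  · rw [← dist_eq_norm]
    exact (mem_closedBall.1 hw).trans_lt hδε
  -- Exponentiating gives `(f w / u) ^ p = (w₁ / u ^ p) * (w / w₁)`, that is, `f w ^ p = w`.
  · have e : p * g w = Complex.log (w₁ / u ^ p) + l w := by
      have := congrArg (fun z : ℂ => p * z) hHw
      simp only [hH, mul_sub, mul_div_cancel₀ _ hpc] at this
      linear_combination this
    have e' := congrArg Complex.exp e
    rw [Complex.exp_nat_mul, Complex.exp_add, hg, hl] at e'
    simp only at e'
    rw [Complex.exp_log (Complex.slitPlane_ne_zero a2), Complex.exp_log (Complex.slitPlane_ne_zero a3),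
      Complex.exp_log (div_ne_zero hw₁ (pow_ne_zero _ hu0)), div_pow,
      div_mul_div_comm, mul_comm (u ^ p) w₁, mul_div_mul_left _ _ hw₁,
      div_left_inj' (pow_ne_zero _ hu0), hf] at e'
    simp only at e'
    rwa [div_pow, div_eq_iff (pow_ne_zero _ a1)] at e'

/-! ### Enumerating isomorphism classes -/

/-- The graphs on some `Fin n`, up to isomorphism. -/
def finGraphSetoid : Setoid (Σ n : ℕ, SimpleGraph (Fin n)) where
  r G H := Nonempty (G.2 ≃g H.2)
  iseqv := ⟨fun _ => ⟨SimpleGraph.Iso.refl⟩, fun ⟨e⟩ => ⟨e.symm⟩, fun ⟨e⟩ ⟨f⟩ => ⟨e.trans f⟩⟩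

/-- A property of finite graphs satisfied by graphs of unboundedly many orders is satisfied, up to
isomorphism, by exactly the graphs of a sequence of pairwise non-isomorphic graphs. -/
theorem exists_seq_finGraph (Φ : (Σ n : ℕ, SimpleGraph (Fin n)) → Prop)
    (hinf : ∀ N, ∃ G, Φ G ∧ N ≤ G.1) :
    ∃ G : ℕ → Σ n : ℕ, SimpleGraph (Fin n),
      (∀ i j, i ≠ j → IsEmpty ((G i).2 ≃g (G j).2)) ∧ (∀ i, Φ (G i)) ∧
      ∀ H, Φ H → ∃ i, Nonempty ((G i).2 ≃g H.2) := by
  classical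
  let S : Set (Quotient finGraphSetoid) := Quotient.mk _ '' {G | Φ G}
  have hcard : ∀ G H : Σ n : ℕ, SimpleGraph (Fin n), finGraphSetoid.r G H → G.1 = H.1 :=
    fun G H ⟨e⟩ => by simpa using Fintype.card_congr e.toEquiv
  -- The order is an isomorphism invariant that is unbounded on `S`.
  have hS : S.Infinite := by
    intro hfin
    obtain ⟨N, hN⟩ := (hfin.image (Quotient.lift Sigma.fst hcard)).bddAbove
    obtain ⟨G, hG, hGN⟩ := hinf (N + 1)
    have : G.1 ≤ N := hN ⟨Quotient.mk _ G, ⟨G, hG, rfl⟩, rfl⟩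
    omega
  have : Infinite S := hS.to_subtype
  obtain ⟨e⟩ : Nonempty (ℕ ≃ S) := ⟨(nonempty_denumerable S).some.eqv.symm⟩
  choose G hG using fun i => (e i).2
  refine ⟨G, fun i j hij => ⟨fun f => hij (e.injective (Subtype.ext ?_))⟩, fun i => (hG i).1,
    fun H hH => ?_⟩
  · rw [← (hG i).2, ← (hG j).2]
    exact Quotient.sound ⟨f⟩
  · refine ⟨e.symm ⟨_, ⟨H, hH, rfl⟩⟩, Quotient.exact (s := finGraphSetoid) ?_⟩
    rw [(hG _).2, e.apply_symm_apply]

/-! ### Density in the plane -/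

/-- The chromatic roots of theta graphs are dense outside the disk `‖q - 1‖ ≤ 1`. -/
theorem exists_mem_chromaticRoots_thetaGraph {q : ℂ} (hq : 1 < ‖q - 1‖) {ε : ℝ} (hε : 0 < ε) :
    ∃ s p : ℕ, 2 ≤ s ∧ 1 ≤ p ∧ ∃ z ∈ chromaticRoots (thetaGraph s p), ‖z - q‖ < ε := by
  have hq' : 1 < ‖1 - q‖ := by rwa [norm_sub_rev]
  obtain ⟨s, hs, w₁, hw₁, hn, h⟩ := exists_norm_pow_sub_eq hq' (half_pos hε)
  have hw₁n : 1 < ‖w₁‖ := hn ▸ hq'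
  -- The radius `‖w₁‖ - 1` excludes the spurious solution `w = 1`.
  obtain ⟨p, hp, w, hw, hpow⟩ := exists_pow_eq_mul_pow hs hw₁n h
    (lt_min (half_pos hε) (sub_pos.2 hw₁n))
  refine ⟨s, p, hs, hp, 1 - w, mem_chromaticRoots_thetaGraph (by omega) p ?_ hpow, ?_⟩
  · rintro rfl
    have h1 := hw.trans_le (min_le_right _ _)
    have h2 := norm_sub_norm_le w₁ 1
    rw [norm_sub_rev, norm_one] at h2
    linarith
  · have h1 := hw.trans_le (min_le_left _ _)
    calc ‖1 - w - q‖ = ‖(w - w₁) + (w₁ - (1 - q))‖ := by rw [← norm_neg]; congr 1; ring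
      _ ≤ ‖w - w₁‖ + ‖w₁ - (1 - q)‖ := norm_add_le _ _
      _ < ε := by linarith

theorem dense_of_chromaticRoots_theta_subset {R : Set ℂ}
    (h₁ : ∀ s p : ℕ, 2 ≤ s → 1 ≤ p → chromaticRoots (thetaGraph s p) ⊆ R)
    (h₂ : ∀ s p : ℕ, 2 ≤ s → 1 ≤ p → chromaticRoots (thetaJoinK2 s p) ⊆ R) : Dense R := by
  -- It suffices that the closure contains the dense set `{2}ᶜ`.
  rw [← dense_closure]
  refine (dense_compl_singleton (2 : ℂ)).mono fun q hq => Metric.mem_closure_iff.2 fun ε hε => ?_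
  by_cases h : 1 < ‖q - 1‖
  · obtain ⟨s, p, hs, hp, z, hz, hzq⟩ := exists_mem_chromaticRoots_thetaGraph h hε
    exact ⟨z, h₁ s p hs hp hz, by rwa [dist_comm, dist_eq_norm]⟩
  · have h' : 1 < ‖(q - 2) - 1‖ := by
      by_contra h'
      push Not at h h'
      -- `q` would lie in both closed unit disks, which touch at `2`
      refine hq ?_
      rw [Set.mem_singleton_iff]
      rw [← sq_le_one_iff₀ (norm_nonneg _), Complex.sq_norm, Complex.normSq_apply] at h h'
      simp at h h'
      apply Complex.ext <;> simp <;> nlinarith [sq_nonneg (q.re - 2), sq_nonneg q.im]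
    obtain ⟨s, p, hs, hp, z, hz, hzq⟩ := exists_mem_chromaticRoots_thetaGraph h' hε
    refine ⟨z + 2, h₂ s p hs hp (mem_chromaticRoots_graphJoin_top _ hz), ?_⟩
    rw [dist_comm, dist_eq_norm]
    rwa [show z + 2 - q = z - (q - 2) by ring]

/-- There is a countably infinite family of pairwise non-isomorphic finite graphs, consisting (up to
isomorphism) exactly of the generalized theta graphs `Θ^{(s,p)}` with `s ≥ 2`, `p ≥ 1` and of their
joins with `K₂`, whose chromatic roots, taken together, are dense in the complex plane. -/
theorem corollary1p3 :
    ∃ (n : ℕ → ℕ) (G : (i : ℕ) → SimpleGraph (Fin (n i))),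
      (∀ i j : ℕ, i ≠ j → IsEmpty (G i ≃g G j)) ∧
      (∀ i : ℕ, ∃ s p : ℕ, 2 ≤ s ∧ 1 ≤ p ∧
        (Nonempty (G i ≃g thetaGraph s p) ∨ Nonempty (G i ≃g thetaJoinK2 s p))) ∧
      (∀ s p : ℕ, 2 ≤ s → 1 ≤ p →
        (∃ i : ℕ, Nonempty (G i ≃g thetaGraph s p)) ∧
        (∃ i : ℕ, Nonempty (G i ≃g thetaJoinK2 s p))) ∧
      Dense (⋃ i : ℕ, chromaticRoots (G i)) := by
  obtain ⟨G, hne, hΦ, hall⟩ := exists_seq_finGraph (fun G => ∃ s p : ℕ, 2 ≤ s ∧ 1 ≤ p ∧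
    (Nonempty (G.2 ≃g thetaGraph s p) ∨ Nonempty (G.2 ≃g thetaJoinK2 s p))) (fun N => by
      refine ⟨⟨_, (thetaGraph 2 (N + 1)).overFin rfl⟩, ⟨2, N + 1, le_rfl, by omega,
        Or.inl ⟨((thetaGraph 2 (N + 1)).overFinIso rfl).symm⟩⟩, ?_⟩
      simp
      omega)
  have hθ : ∀ s p : ℕ, 2 ≤ s → 1 ≤ p → ∃ i, Nonempty ((G i).2 ≃g thetaGraph s p) := by
    intro s p hs hp
    let e := ((thetaGraph s p).overFinIso rfl).symm
    obtain ⟨i, ⟨f⟩⟩ := hall ⟨_, (thetaGraph s p).overFin rfl⟩ ⟨s, p, hs, hp, Or.inl ⟨e⟩⟩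
    exact ⟨i, ⟨f.trans e⟩⟩
  have hJ : ∀ s p : ℕ, 2 ≤ s → 1 ≤ p → ∃ i, Nonempty ((G i).2 ≃g thetaJoinK2 s p) := by
    intro s p hs hp
    let e := ((thetaJoinK2 s p).overFinIso rfl).symm
    obtain ⟨i, ⟨f⟩⟩ := hall ⟨_, (thetaJoinK2 s p).overFin rfl⟩ ⟨s, p, hs, hp, Or.inr ⟨e⟩⟩
    exact ⟨i, ⟨f.trans e⟩⟩
  refine ⟨fun i => (G i).1, fun i => (G i).2, hne, hΦ, fun s p hs hp => ⟨hθ s p hs hp, hJ s p hs hp⟩,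
    dense_of_chromaticRoots_theta_subset (fun s p hs hp => ?_) (fun s p hs hp => ?_)⟩
  · obtain ⟨i, ⟨f⟩⟩ := hθ s p hs hp
    rw [← chromaticRoots_congr f]
    exact Set.subset_iUnion (fun i => chromaticRoots (G i).2) i
  · obtain ⟨i, ⟨f⟩⟩ := hJ s p hs hp
    rw [← chromaticRoots_congr f]
    exact Set.subset_iUnion (fun i => chromaticRoots (G i).2) i
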